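/- Let $R$ be an associative ring with identity and let $C$ be a cyclic right $R$-module such that every cyclic subfactor of $C$ (that is, every cyclic module of the form $X/D$ with submodules $D\subseteq X\subseteq C$) is CS, noetherian, or projective. Here a module is called CS if each of its complement submodules is a direct summand, where a submodule $N$ of $M$ is a complement submodule if, for some submodule $K$ of $M$, it is maximal among the submodules $L$ of $M$ with $L\cap K=0$. (a) Then $C$ has finite uniform dimension, i.e. $C$ has an essential submodule that is a direct sum of finitely many (possibly zero) uniform submodules. (b) If moreover $R$ is a right WV-ring, i.e. every simple right $R$-module is $R/A$-injective for every right ideal $A$ of $R$ such that $R/A\not\cong R$ as right $R$-modules, then $C$ is noetherian. (A module $E$ is $M$-injective if every homomorphism from a submodule of $M$ to $E$ extends to $M$; a nonzero module is uniform if any two of its nonzero submodules have nonzero intersection; a submodule is essential if it meets every nonzero submodule nontrivially.) -/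

import Mathlib

universe u v

section ModuleNotions

variable (S : Type u) [Ring S] (M : Type v) [AddCommGroup M] [Module S M]

/-- A submodule is essential if it meets every nonzero submodule nontrivially. -/
def IsEssentialSubmodule {S : Type u} [Ring S] {M : Type v} [AddCommGroup M] [Module S M]
    (N : Submodule S M) : Prop :=
  ∀ K : Submodule S M, N ⊓ K = ⊥ → K = ⊥

/-- A module is uniform if it is nonzero and any two nonzero submodules intersect nontrivially. -/
def IsUniformModule : Prop :=
  Nontrivial M ∧ ∀ A B : Submodule S M, A ≠ ⊥ → B ≠ ⊥ → A ⊓ B ≠ ⊥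

/-- Finite uniform dimension: some finite direct sum of uniform submodules is essential. -/
def HasFiniteUniformDimension : Prop :=
  ∃ (n : ℕ) (U : Fin n → Submodule S M),
    (∀ i, IsUniformModule S (U i)) ∧ iSupIndep U ∧ IsEssentialSubmodule (⨆ i, U i)

/-- A complement submodule: one that is maximal among the submodules having zero intersection
with some submodule `K`. -/
def IsComplementSubmodule {S : Type u} [Ring S] {M : Type v} [AddCommGroup M] [Module S M]
    (N : Submodule S M) : Prop :=
  ∃ K : Submodule S M, Maximal (fun L : Submodule S M => L ⊓ K = ⊥) N

/-- A CS module: every complement submodule is a direct summand. -/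
def IsCSModule : Prop :=
  ∀ N : Submodule S M, IsComplementSubmodule N → ∃ N' : Submodule S M, IsCompl N N'

/-- `E` is `M`-injective: every homomorphism from a submodule of `M` to `E` extends to `M`. -/
def IsInjectiveRelativeTo (E : Type*) [AddCommGroup E] [Module S E] : Prop :=
  ∀ (N : Submodule S M) (f : N →ₗ[S] E), ∃ g : M →ₗ[S] E, ∀ x : N, g x = f x

end ModuleNotions

/-- A right WV-ring: every simple right module is `R/A`-injective for each right ideal `A` such
that `R/A` and `R` are not isomorphic as right modules. Right modules over `R` are modules over
`Rᵐᵒᵖ`. Every simple right module is isomorphic to one in the universe of `R`. -/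
def IsRightWVRing (R : Type u) [Ring R] : Prop :=
  ∀ A : Submodule Rᵐᵒᵖ R, ¬ Nonempty ((R ⧸ A) ≃ₗ[Rᵐᵒᵖ] R) →
    ∀ (E : Type u) [AddCommGroup E] [Module Rᵐᵒᵖ E], IsSimpleModule Rᵐᵒᵖ E →
      IsInjectiveRelativeTo Rᵐᵒᵖ (R ⧸ A) E

/-! The engine is `isCSModule_quotient`. If `D` is not finitely generated, the cyclic module `M ⧸ D`
is not projective, since a finitely generated projective module is finitely presented. So if `M ⧸ D`
is also not noetherian, it is CS, and closures in it are summands, hence cyclic.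

For (a), infinite direct sums are excluded (`not_containsInfiniteDirectSum`). Factoring out every
other term leaves a cyclic CS module that still contains an infinite direct sum. Splitting off
non-simple summands `U n` forever, then factoring out a nonzero maximal submodule of each, gives
independent simple modules whose finite partial sums are summands. In `false_of_simple_summands`
their sum `T` is cut into infinite blocks with closures `E k`, and the closure of `⨆ E k` modulo `T`
has the form `(S ∙ x) ⊔ T`. The module `S ∙ x` meets every block; a second closure, taken inside `S
∙ x`, is forced down into `T` and gives the contradiction (`false_of_closure`).

For (b), a cyclic module over a WV-ring is either isomorphic to `R` or has all simple modules
injective relative to it. In the second case (a) makes it noetherian (`isNoetherian_of_injective`).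
A non-noetherian `C` has a non-noetherian quotient by a nonzero submodule; this quotient is then
isomorphic to `R`, so it splits off, and iterating produces an infinite direct sum. -/

namespace CyclicSubfactor

section Submodules

variable {S : Type u} [Ring S] {M : Type v} [AddCommGroup M] [Module S M]

/-! ### Independent families and their quotients -/

theorem biSup_inf_iSup_of_le {f K : ℕ → Submodule S M} (hf : iSupIndep f) (hK : ∀ i, K i ≤ f i)
    (s : Set ℕ) : (⨆ i ∈ s, f i) ⊓ ⨆ i, K i = ⨆ i ∈ s, K i := by
  have h1 : (⨆ i, K i) = (⨆ i ∈ s, K i) ⊔ ⨆ i ∈ sᶜ, K i := by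
    rw [← iSup_union, Set.union_compl_self]; simp
  have h2 : Disjoint (⨆ i ∈ s, f i) (⨆ i ∈ sᶜ, f i) :=
    hf.disjoint_biSup_biSup disjoint_compl_right
  have h3 : (⨆ i ∈ s, K i) ≤ ⨆ i ∈ s, f i := iSup₂_mono fun i _ => hK i
  have h4 : (⨆ i ∈ sᶜ, K i) ≤ ⨆ i ∈ sᶜ, f i := iSup₂_mono fun i _ => hK i
  rw [h1, inf_comm, sup_inf_assoc_of_le _ h3, inf_comm, (h2.mono_right h4).eq_bot, sup_bot_eq]

theorem inf_iSup_of_le {f K : ℕ → Submodule S M} (hf : iSupIndep f) (hK : ∀ i, K i ≤ f i)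
    (k : ℕ) : f k ⊓ ⨆ i, K i = K k := by
  simpa using biSup_inf_iSup_of_le hf hK {k}

theorem iSupIndep_map_mkQ {f K : ℕ → Submodule S M} (hf : iSupIndep f) (hK : ∀ i, K i ≤ f i) :
    iSupIndep fun i => (f i).map (⨆ i, K i).mkQ := by
  intro i
  set Q := ⨆ i, K i with hQ
  have hle : Q ≤ (⨆ j, ⨆ _ : j ≠ i, f j) ⊔ K i := by
    refine iSup_le fun j => ?_
    by_cases h : j = i
    · subst h; exact le_sup_right
    · exact ((hK j).trans (le_iSup₂_of_le j h le_rfl)).trans le_sup_left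
  have hG : f i ⊓ ((⨆ j, ⨆ _ : j ≠ i, f j) ⊔ K i) = K i := by
    rw [inf_comm, sup_comm, sup_inf_assoc_of_le _ (hK i), inf_comm, (hf i).eq_bot, sup_bot_eq]
  have hmap : (⨆ j, ⨆ _ : j ≠ i, (f j).map Q.mkQ) = (⨆ j, ⨆ _ : j ≠ i, f j).map Q.mkQ := by
    simp only [Submodule.map_iSup]
  rw [disjoint_iff, hmap]
  apply Submodule.comap_injective_of_surjective Q.mkQ_surjective
  simp only [Submodule.comap_inf, Submodule.comap_map_mkQ, Submodule.comap_bot, Submodule.ker_mkQ]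
  refine le_antisymm ?_ (le_inf le_sup_left le_sup_left)
  have h5 : Q ⊔ (⨆ j, ⨆ _ : j ≠ i, f j) ≤ (⨆ j, ⨆ _ : j ≠ i, f j) ⊔ K i :=
    sup_le hle le_sup_left
  refine (inf_le_inf_left _ h5).trans ?_
  rw [sup_inf_assoc_of_le _ hle, hG]
  exact sup_le le_rfl (le_iSup K i)

theorem map_mkQ_ne_bot {f K : ℕ → Submodule S M} (hf : iSupIndep f) (hK : ∀ i, K i ≤ f i) {k : ℕ}
    (hk : K k ≠ f k) : (f k).map (⨆ i, K i).mkQ ≠ ⊥ := by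
  intro h
  rw [← le_bot_iff, Submodule.map_le_iff_le_comap, Submodule.comap_bot, Submodule.ker_mkQ] at h
  exact hk ((inf_iSup_of_le hf hK k).symm.trans (inf_eq_left.2 h))

theorem exists_le_biSup_Iio {F : Submodule S M} (hF : F.FG) {f : ℕ → Submodule S M}
    (h : F ≤ ⨆ i, f i) : ∃ n, F ≤ ⨆ i ∈ Set.Iio n, f i := by
  obtain ⟨s, hs⟩ := CompleteLattice.IsCompactElement.exists_finset_of_le_iSup _
    ((Submodule.fg_iff_compact F).1 hF) _ h
  refine ⟨s.sup id + 1, hs.trans (iSup₂_le fun i hi => le_iSup₂_of_le i ?_ le_rfl)⟩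
  exact Nat.lt_succ_of_le (Finset.le_sup (f := id) hi)

/-- A finitely generated `F` lies in finitely many terms, so replacing `K i` by `f i` for those `i`
absorbs it; a later term with `K k ≠ f k` is unaffected. Thus `⨆ f` is not finitely generated modulo
`⨆ K`. -/
theorem iSup_ne_fg_sup_iSup {f K : ℕ → Submodule S M} (hf : iSupIndep f) (hK : ∀ i, K i ≤ f i)
    (hne : ∀ n, ∃ k, n ≤ k ∧ K k ≠ f k) {F : Submodule S M} (hF : F.FG) :
    (⨆ i, f i) ≠ F ⊔ ⨆ i, K i := by
  intro h
  obtain ⟨n, hn⟩ := exists_le_biSup_Iio hF (h ▸ le_sup_left : F ≤ ⨆ i, f i)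
  obtain ⟨k, hnk, hk⟩ := hne n
  classical
  let K' : ℕ → Submodule S M := fun i => if i < n then f i else K i
  have hK' : ∀ i, K' i ≤ f i := fun i => by dsimp only [K']; split_ifs; exacts [le_rfl, hK i]
  have h1 : F ⊔ ⨆ i, K i ≤ ⨆ i, K' i := by
    refine sup_le (hn.trans (iSup₂_le fun i hi => le_iSup_of_le i ?_))
      (iSup_mono fun i => ?_)
    · simp only [K', if_pos (Set.mem_Iio.1 hi), le_refl]
    · dsimp only [K']; split_ifs; exacts [hK i, le_rfl]
  have h2 := inf_iSup_of_le hf hK' k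
  rw [inf_eq_left.2 (((le_iSup f k).trans h.le).trans h1)] at h2
  simp only [K', if_neg (not_lt.2 hnk)] at h2
  exact hk h2.symm

theorem not_fg_iSup {f : ℕ → Submodule S M} (hf : iSupIndep f) (hne : ∀ i, f i ≠ ⊥) :
    ¬ (⨆ i, f i).FG := fun h =>
  iSup_ne_fg_sup_iSup hf (K := fun _ => ⊥) (fun _ => bot_le) (fun n => ⟨n, le_rfl, (hne n).symm⟩) h
    (by simp)

/-! ### Essential closures in CS modules -/

/-- `B` is essential in `N`. -/
def IsEssentialIn (B N : Submodule S M) : Prop :=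
  B ≤ N ∧ ∀ Z ≤ N, Z ⊓ B = ⊥ → Z = ⊥

theorem exists_maximal_inf_eq_bot (K B : Submodule S M) (h : B ⊓ K = ⊥) :
    ∃ N, B ≤ N ∧ Maximal (fun L : Submodule S M => L ⊓ K = ⊥) N := by
  obtain ⟨N, hN, hmax⟩ := zorn_le_nonempty₀ {L : Submodule S M | L ⊓ K = ⊥} (fun c hc hch y hy => by
    refine ⟨sSup c, ?_, fun z hz => le_sSup hz⟩
    have : DirectedOn (· ≤ ·) c := hch.directedOn
    change sSup c ⊓ K = ⊥
    rw [this.sSup_inf_eq]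
    simp only [iSup_eq_bot]
    exact fun a ha => hc ha) B h
  exact ⟨N, hN, hmax⟩

/-- Take `K` maximal disjoint from `B`, then `N ≥ B` maximal disjoint from `K`. If `Z ≤ N` misses
`B`, so does `K ⊔ Z`; maximality puts `Z` inside `K`, hence `Z = ⊥`. -/
theorem exists_essential_closure (hCS : IsCSModule S M) (B : Submodule S M) :
    ∃ N N', IsCompl N N' ∧ IsEssentialIn B N := by
  obtain ⟨K, -, hK⟩ := exists_maximal_inf_eq_bot B ⊥ (bot_inf_eq B)
  obtain ⟨N, hBN, hN⟩ := exists_maximal_inf_eq_bot K B (by rw [inf_comm]; exact hK.prop)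
  obtain ⟨N', hN'⟩ := hCS N ⟨K, hN⟩
  refine ⟨N, N', hN', hBN, fun Z hZ hZB => ?_⟩
  have hNK : Disjoint N K := disjoint_iff.2 hN.prop
  have h1 : Disjoint (K ⊔ Z) B := by
    refine Disjoint.disjoint_sup_left_of_disjoint_sup_right (disjoint_iff.2 hZB) ?_
    exact hNK.symm.mono_right (sup_le hZ hBN)
  have h2 : Z ≤ K := le_sup_right.trans (hK.le_of_ge h1.eq_bot le_sup_left)
  exact disjoint_self.1 (hNK.mono hZ h2)

theorem IsEssentialIn.disjoint {B N Z : Submodule S M} (h : IsEssentialIn B N)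
    (hZ : Disjoint B Z) : Disjoint N Z :=
  disjoint_iff.2 (h.2 _ inf_le_left
    (le_bot_iff.1 (hZ.le_bot.trans' (le_inf inf_le_right (inf_le_left.trans inf_le_right)))))

theorem iSupIndep_of_isEssentialIn {f g : ℕ → Submodule S M} (hf : iSupIndep f)
    (h : ∀ i, IsEssentialIn (f i) (g i)) : iSupIndep g := by
  classical
  -- Exchange one index at a time: closures over `s`, original terms over `t`.
  have key : ∀ s t : Finset ℕ, Disjoint s t → Disjoint (s.sup g) (t.sup f) := by
    intro s
    induction s using Finset.induction_on with
    | empty => simp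
    | insert i s hi ih =>
      intro t ht
      rw [Finset.disjoint_insert_left] at ht
      have h1 : Disjoint (s.sup g) (f i ⊔ t.sup f) := by
        simpa using ih (insert i t) (by simp [Finset.disjoint_insert_right, hi, ht.2])
      have h2 : Disjoint (f i) (t.sup f) := by
        have := hf.disjoint_biSup (x := i) (y := (t : Set ℕ)) (by simpa using ht.1)
        simpa [Finset.sup_eq_iSup] using this
      have h3 : Disjoint (f i) (t.sup f ⊔ s.sup g) :=
        h2.disjoint_sup_right_of_disjoint_sup_left h1.symm
      have h4 : Disjoint (g i) (t.sup f ⊔ s.sup g) := (h i).disjoint h3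
      rw [Finset.sup_insert]
      refine Disjoint.disjoint_sup_left_of_disjoint_sup_right (h1.mono_right le_sup_right) ?_
      rwa [sup_comm]
  rw [iSupIndep_iff_supIndep]
  intro s t hts i his hit
  have := key t {i} (by simpa using hit)
  rw [Finset.sup_singleton] at this
  exact (h i).disjoint this.symm

/-! ### The subfactor condition and CS quotients -/

variable (S M) in
/-- Every cyclic subfactor is CS, noetherian or projective, with subfactors presented as
quotients of submodules up to isomorphism. -/
def SubfactorCondition : Prop :=
  ∀ (X : Submodule S M) (N : Type v) [AddCommGroup N] [Module S N] (g : X →ₗ[S] N),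
    Function.Surjective g → Module.IsPrincipal S N →
      IsCSModule S N ∨ IsNoetherian S N ∨ Module.Projective S N

theorem isCSModule_of_equiv {N N' : Type*} [AddCommGroup N] [Module S N] [AddCommGroup N']
    [Module S N'] (e : N ≃ₗ[S] N') (h : IsCSModule S N) : IsCSModule S N' := by
  rintro L ⟨K, hK⟩
  let o : Submodule S N' ≃o Submodule S N := Submodule.orderIsoMapComap e.symm
  obtain ⟨L', hL'⟩ := h (o L) ⟨o K, by
    refine ⟨?_, fun T hT hLT => ?_⟩
    · change o L ⊓ o K = ⊥
      rw [← map_inf, hK.prop, map_bot]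
    · have h1 : o.symm T ⊓ K = ⊥ := by
        rw [← o.symm_apply_apply K, ← map_inf, hT, map_bot]
      have h2 := hK.le_of_ge h1 (by rwa [← o.le_symm_apply] at hLT)
      rwa [← o.symm_apply_le]⟩
  exact ⟨o.symm L', by simpa using o.symm.isCompl hL'⟩

theorem SubfactorCondition.of_surjective (hM : SubfactorCondition S M) (X : Submodule S M)
    {N : Type v} [AddCommGroup N] [Module S N] (g : X →ₗ[S] N) (hg : Function.Surjective g) :
    SubfactorCondition S N := by
  intro Y P _ _ h hh hP
  let X' : Submodule S M := (Y.comap g).map X.subtype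
  let e : Y.comap g ≃ₗ[S] X' := Submodule.equivSubtypeMap X (Y.comap g)
  let g' : Y.comap g →ₗ[S] Y := g.restrict (fun x hx => hx)
  have hg' : Function.Surjective g' := by
    rintro ⟨y, hy⟩
    obtain ⟨x, rfl⟩ := hg y
    exact ⟨⟨x, hy⟩, rfl⟩
  exact hM X' P (h ∘ₗ g' ∘ₗ e.symm.toLinearMap)
    (hh.comp (hg'.comp e.symm.surjective)) hP

theorem SubfactorCondition.submodule (hM : SubfactorCondition S M) (X : Submodule S M) :
    SubfactorCondition S X :=
  hM.of_surjective X LinearMap.id Function.surjective_id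

theorem SubfactorCondition.quotient (hM : SubfactorCondition S M) (D : Submodule S M) :
    SubfactorCondition S (M ⧸ D) :=
  hM.of_surjective ⊤ (D.mkQ ∘ₗ (⊤ : Submodule S M).subtype)
    (D.mkQ_surjective.comp fun x => ⟨⟨x, trivial⟩, rfl⟩)

theorem SubfactorCondition.self (hM : SubfactorCondition S M) (h : Module.IsPrincipal S M) :
    IsCSModule S M ∨ IsNoetherian S M ∨ Module.Projective S M :=
  hM ⊤ M (⊤ : Submodule S M).subtype (fun x => ⟨⟨x, trivial⟩, rfl⟩) h

theorem subfactorCondition_of_forall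
    (h : ∀ (X : Submodule S M) (D : Submodule S X), Module.IsPrincipal S (X ⧸ D) →
      IsCSModule S (X ⧸ D) ∨ IsNoetherian S (X ⧸ D) ∨ Module.Projective S (X ⧸ D)) :
    SubfactorCondition S M := by
  intro X N _ _ g hg hN
  let e := g.quotKerEquivOfSurjective hg
  rcases h X (LinearMap.ker g) (hN.of_surjective e.symm.toLinearMap e.symm.surjective)
    with h | h | h
  · exact Or.inl (isCSModule_of_equiv e h)
  · exact Or.inr (Or.inl (isNoetherian_of_linearEquiv e))
  · exact Or.inr (Or.inr (Module.Projective.of_equiv e))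

theorem isPrincipal_quotient (h : Module.IsPrincipal S M) (D : Submodule S M) :
    Module.IsPrincipal S (M ⧸ D) :=
  h.of_surjective D.mkQ D.mkQ_surjective

theorem exists_span_singleton_of_isCompl (h : Module.IsPrincipal S M) {N N' : Submodule S M}
    (hN : IsCompl N N') : ∃ a, N = S ∙ a := by
  obtain ⟨m, hm⟩ := h.principal
  obtain ⟨a, ha, b, hb, rfl⟩ := Submodule.mem_sup.1 (hN.sup_eq_top ▸ Submodule.mem_top : m ∈ N ⊔ N')
  refine ⟨a, le_antisymm (fun n hn => ?_) ((Submodule.span_singleton_le_iff_mem _ _).2 ha)⟩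
  obtain ⟨r, rfl⟩ := Submodule.mem_span_singleton.1 (hm ▸ Submodule.mem_top : n ∈ S ∙ (a + b))
  have h1 : r • b ∈ N := by
    have := N.sub_mem hn (N.smul_mem r ha)
    rwa [smul_add, add_sub_cancel_left] at this
  have h2 : r • b = 0 := Submodule.disjoint_def.1 hN.disjoint _ h1 (N'.smul_mem r hb)
  rw [smul_add, h2, add_zero]
  exact Submodule.smul_mem _ _ (Submodule.mem_span_singleton_self a)

theorem fg_of_isCompl (h : Module.IsPrincipal S M) {N N' : Submodule S M}
    (hN : IsCompl N N') : N.FG := by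
  obtain ⟨a, rfl⟩ := exists_span_singleton_of_isCompl h hN
  exact Submodule.fg_span_singleton a

theorem finite_of_isPrincipal (h : Module.IsPrincipal S M) : Module.Finite S M :=
  ⟨h.fg⟩

theorem not_projective_quotient (h : Module.IsPrincipal S M) {D : Submodule S M} (hD : ¬ D.FG) :
    ¬ Module.Projective S (M ⧸ D) := by
  intro hP
  have := finite_of_isPrincipal h
  have : Module.FinitePresentation S (M ⧸ D) := Module.finitePresentation_of_projective _ _
  have h1 := Module.FinitePresentation.fg_ker D.mkQ D.mkQ_surjective
  rw [Submodule.ker_mkQ] at h1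
  exact hD h1

theorem isCSModule_quotient (hM : SubfactorCondition S M) (h : Module.IsPrincipal S M)
    {D : Submodule S M} (hD : ¬ D.FG) (hn : ¬ IsNoetherian S (M ⧸ D)) : IsCSModule S (M ⧸ D) :=
  (((hM.quotient D).self (isPrincipal_quotient h D)).resolve_right
    (not_or.2 ⟨hn, not_projective_quotient h hD⟩))

/-- `hB` says that `B` is not finitely generated modulo `O`, so `M ⧸ O` is not noetherian and hence
CS. The closure of the image of `B` is a summand of a cyclic module, which yields the generator `y`.
-/
theorem exists_closure_modulo_aux (hM : SubfactorCondition S M) (h : Module.IsPrincipal S M)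
    {O B : Submodule S M} (hO : ¬ O.FG) (hOB : O ≤ B)
    (hB : ∀ F : Submodule S M, F.FG → B ≠ F ⊔ O) :
    ∃ (Y : Submodule S M) (y : M), B ≤ Y ∧ Y = (S ∙ y) ⊔ O ∧
      ∀ Z ≤ Y, O ≤ Z → Z ⊓ B = O → Z = O := by
  have hmap : (B.map O.mkQ).comap O.mkQ = B := by
    rw [Submodule.comap_map_mkQ, sup_eq_right.2 hOB]
  have hn : ¬ IsNoetherian S (M ⧸ O) := by
    intro hn
    obtain ⟨s, hs⟩ := hn.noetherian (B.map O.mkQ)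
    choose σ hσ using O.mkQ_surjective
    classical
    refine hB (Submodule.span S (s.image σ : Finset M)) ⟨_, rfl⟩ ?_
    rw [← hmap, ← hs, sup_comm, ← Submodule.comap_map_mkQ, Submodule.map_span, Finset.coe_image,
      ← Set.image_comp, show ⇑O.mkQ ∘ σ = id from funext hσ, Set.image_id]
  obtain ⟨N, N', hN, hBN, hess⟩ :=
    exists_essential_closure (isCSModule_quotient hM h hO hn) (B.map O.mkQ)
  obtain ⟨a, ha⟩ := exists_span_singleton_of_isCompl (isPrincipal_quotient h O) hN
  obtain ⟨y, rfl⟩ := O.mkQ_surjective a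
  refine ⟨N.comap O.mkQ, y, Submodule.map_le_iff_le_comap.1 hBN, ?_, fun Z hZ hOZ hZB => ?_⟩
  · rw [ha, sup_comm, ← Submodule.comap_map_mkQ, Submodule.map_span, Set.image_singleton]
  · have h1 := hess (Z.map O.mkQ) (Submodule.map_le_iff_le_comap.2 hZ) (by
      apply Submodule.comap_injective_of_surjective O.mkQ_surjective
      rw [Submodule.comap_inf, hmap, Submodule.comap_map_mkQ, sup_eq_right.2 hOZ, hZB,
        Submodule.comap_bot, Submodule.ker_mkQ])
    refine le_antisymm ?_ hOZ
    rwa [← le_bot_iff, Submodule.map_le_iff_le_comap, Submodule.comap_bot,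
      Submodule.ker_mkQ] at h1

theorem exists_closure_modulo (hM : SubfactorCondition S M) (x : M) {O B : Submodule S M}
    (hO : ¬ O.FG) (hOB : O ≤ B) (hBX : B ≤ S ∙ x)
    (hB : ∀ F : Submodule S M, F.FG → B ≠ F ⊔ O) :
    ∃ (Y : Submodule S M) (y : M), B ≤ Y ∧ Y ≤ S ∙ x ∧ Y = (S ∙ y) ⊔ O ∧
      ∀ Z ≤ Y, O ≤ Z → Z ⊓ B = O → Z = O := by
  set X : Submodule S M := S ∙ x
  have hmap : ∀ L ≤ X, (L.comap X.subtype).map X.subtype = L := fun L hL => by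
    rw [Submodule.map_comap_subtype, inf_eq_right.2 hL]
  have hcomap : ∀ L : Submodule S X, (L.map X.subtype).comap X.subtype = L := fun L =>
    Submodule.comap_map_eq_of_injective X.injective_subtype L
  have hX : Module.IsPrincipal S X := by
    refine ⟨⟨x, Submodule.mem_span_singleton_self x⟩, ?_⟩
    apply Submodule.map_injective_of_injective X.injective_subtype
    rw [Submodule.map_span, Set.image_singleton]
    simp [X]
  obtain ⟨Y, y, hBY, hY, hess⟩ := exists_closure_modulo_aux (hM.submodule X) hX
    (O := O.comap X.subtype) (B := B.comap X.subtype)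
    (fun h => hO (by simpa only [hmap O (hOB.trans hBX)] using h.map X.subtype))
    (Submodule.comap_mono hOB) (fun F hF h => hB (F.map X.subtype) (hF.map _) (by
      rw [← hmap B hBX, h, Submodule.map_sup, hmap O (hOB.trans hBX)]))
  refine ⟨Y.map X.subtype, y, ?_, Submodule.map_subtype_le X Y, ?_, fun Z hZ hOZ hZB => ?_⟩
  · rw [← hmap B hBX]; exact Submodule.map_mono hBY
  · rw [hY, Submodule.map_sup, hmap O (hOB.trans hBX), Submodule.map_span, Set.image_singleton]
    rfl
  · have h1 := hess (Z.comap X.subtype)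
      (by rw [← hcomap Y]; exact Submodule.comap_mono hZ) (Submodule.comap_mono hOZ)
      (by rw [← Submodule.comap_inf, hZB])
    have hZX : Z ≤ X := hZ.trans (Submodule.map_subtype_le X Y)
    rw [← hmap Z hZX, h1, hmap O (hOB.trans hBX)]

/-! ### Infinitely many simple submodules in a cyclic CS module -/

theorem exists_isCompl_of_le {P Q F : Submodule S M} [IsSemisimpleModule S P] (hPQ : IsCompl P Q)
    (hF : F ≤ P) : ∃ F', IsCompl F F' := by
  have : ComplementedLattice (Set.Iic P) := P.mapIic.complementedLattice_iff.1 inferInstance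
  obtain ⟨⟨c, hcP⟩, hc⟩ := exists_isCompl (⟨F, hF⟩ : Set.Iic P)
  have hd : Disjoint F c := by
    have := congrArg Subtype.val hc.inf_eq_bot
    exact disjoint_iff.2 this
  have hs : F ⊔ c = P := congrArg Subtype.val hc.sup_eq_top
  exact ⟨c ⊔ Q, hd.isCompl_sup_right_of_isCompl_sup_left (by rwa [hs])⟩

theorem iSupIndep_iSup_pair {W : ℕ → Submodule S M} (hW : iSupIndep W) :
    iSupIndep fun k => ⨆ j, W (Nat.pair k j) := by
  intro k
  have h := hW.disjoint_biSup_biSup (s := {i | i.unpair.1 = k}) (t := {i | i.unpair.1 = k}ᶜ)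
    disjoint_compl_right
  refine h.mono (iSup_le fun j => le_iSup₂_of_le (Nat.pair k j) (by simp) le_rfl)
    (iSup₂_le fun l hl => iSup_le fun j => le_iSup₂_of_le (Nat.pair l j) (by simpa using hl) le_rfl)

/-- With zero intersection, `B` would embed in `M ⧸ X` inside the image of `P`, all of whose
submodules are finitely generated. -/
theorem inf_ne_bot_of_le_sup {B X P : Submodule S M} (hB : ¬ B.FG) (hP : ∀ T ≤ P, T.FG)
    (h : B ≤ X ⊔ P) : B ⊓ X ≠ ⊥ := by
  intro hk
  have h3 : B.map X.mkQ ≤ P.map X.mkQ := by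
    rw [Submodule.map_le_iff_le_comap, Submodule.comap_map_mkQ]
    exact h
  refine hB (Submodule.fg_of_fg_map_of_fg_inf_ker X.mkQ ?_ ?_)
  · have h5 := (hP _ (inf_le_left : P ⊓ (B.map X.mkQ).comap X.mkQ ≤ _)).map X.mkQ
    rwa [← Submodule.map_inf_eq_map_inf_comap, inf_eq_right.2 h3] at h5
  · rw [Submodule.ker_mkQ, hk]
    exact Submodule.fg_bot

theorem exists_le_sup_biSup_Iio {F X : Submodule S M} (hF : F.FG) {f : ℕ → Submodule S M}
    (h : F ≤ X ⊔ ⨆ i, f i) : ∃ n, F ≤ X ⊔ ⨆ i ∈ Set.Iio n, f i := by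
  have h1 : F ≤ ⨆ i, (X ⊔ f i) :=
    h.trans (sup_le (le_iSup_of_le 0 le_sup_left) (iSup_mono fun i => le_sup_right))
  obtain ⟨n, hn⟩ := exists_le_biSup_Iio hF h1
  refine ⟨n, hn.trans (iSup₂_le fun i hi => sup_le_sup le_rfl ?_)⟩
  exact le_iSup₂_of_le (f := fun i (_ : i ∈ Set.Iio n) => f i) i hi le_rfl

/-- Let `Y` be the closure of `⨆ V` in `S ∙ x` modulo the odd-indexed terms. It meets `⨆ E` only in
`⨆ V`, so `Y ⊔ T` meets `⨆ E` only in `T`, and `hDess` gives `Y ≤ T`. Then `Y = ⨆ V` is cyclic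
modulo the odd terms, which the even terms forbid. -/
theorem false_of_closure (hM : SubfactorCondition S M) {E V : ℕ → Submodule S M}
    (hE : iSupIndep E) (hVE : ∀ k, V k ≤ E k) (hV0 : ∀ k, V k ≠ ⊥) (hVfg : ∀ k, (V k).FG)
    {T D : Submodule S M} (hVT : (⨆ k, V k) ≤ T) (hTE : T ≤ ⨆ k, E k) (hED : (⨆ k, E k) ≤ D)
    (hsummand : ∀ F : Submodule S M, F.FG → F ≤ T → ∃ F', IsCompl F F') {x : M}
    (hxD : S ∙ x ≤ D) (hVx : ∀ k, V k ≤ S ∙ x)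
    (hDess : ∀ Z ≤ D, T ≤ Z → Z ⊓ (⨆ k, E k) = T → Z = T) : False := by
  have hVind : iSupIndep V := hE.mono hVE
  let O : ℕ → Submodule S M := fun k => if Odd k then V k else ⊥
  have hOV : ∀ k, O k ≤ V k := fun k => by dsimp only [O]; split_ifs; exacts [le_rfl, bot_le]
  have hOne : ∀ n, ∃ k, n ≤ k ∧ O k ≠ V k := fun n => ⟨2 * n, by omega, by
    have : ¬ Odd (2 * n) := by simp
    simp only [O, if_neg this]
    exact (hV0 _).symm⟩
  have hOfg : ¬ (⨆ k, O k).FG := by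
    have hle : (⨆ n, V (2 * n + 1)) = ⨆ k, O k := by
      refine le_antisymm (iSup_le fun n => le_iSup_of_le (2 * n + 1) ?_) (iSup_le fun k => ?_)
      · have : Odd (2 * n + 1) := ⟨n, rfl⟩
        simp only [O, if_pos this, le_refl]
      · by_cases hk : Odd k
        · obtain ⟨n, rfl⟩ := hk
          exact (hOV _).trans (le_iSup (fun n => V (2 * n + 1)) n)
        · simp only [O, if_neg hk, bot_le]
    rw [← hle]
    exact not_fg_iSup (hVind.comp fun a b h => by simpa using h) fun n => hV0 _
  have hOVle : (⨆ k, O k) ≤ ⨆ k, V k := iSup_mono hOV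
  obtain ⟨Y, y, hVY, hYx, hY, hYess⟩ := exists_closure_modulo hM x hOfg hOVle
    (iSup_le hVx) (fun F hF => iSup_ne_fg_sup_iSup hVind hOV hOne hF)
  -- Essentiality modulo `⨆ O` becomes plain essentiality because `⨆ O ≤ ⨆ V`: apply `hYess` to `Z ⊔
  -- ⨆ O`.
  have hYess' : ∀ Z ≤ Y, Z ⊓ (⨆ k, V k) = ⊥ → Z = ⊥ := by
    intro Z hZ hZV
    have h1 := hYess (Z ⊔ ⨆ k, O k) (sup_le hZ (hOVle.trans hVY)) le_sup_right (by
      rw [sup_comm, sup_inf_assoc_of_le _ hOVle, hZV, sup_bot_eq])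
    have h2 : Z ≤ ⨆ k, V k := (le_sup_left.trans h1.le).trans hOVle
    rwa [inf_eq_left.2 h2] at hZV
  have hYE : Y ⊓ (⨆ k, E k) ≤ ⨆ k, V k := by
    rintro z ⟨hzY, hzE⟩
    obtain ⟨n, hn⟩ := exists_le_biSup_Iio (Submodule.fg_span_singleton z)
      ((Submodule.span_singleton_le_iff_mem z _).2 hzE)
    have hVn : (⨆ i ∈ Set.Iio n, V i).FG :=
      by simpa using Submodule.fg_biSup (Finset.range n) V fun i _ => hVfg i
    have hVnV : (⨆ i ∈ Set.Iio n, V i) ≤ ⨆ k, V k := iSup₂_le fun i _ => le_iSup V i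
    obtain ⟨Q, hQ⟩ := hsummand _ hVn (hVnV.trans hVT)
    have hEV := biSup_inf_iSup_of_le hE hVE (Set.Iio n)
    -- The finite partial sum of `V` is a summand with complement `Q`; any excess of `Y` over it
    -- inside the `E i` would show up in `Q`, disjoint from `⨆ V`.
    have h1 : Y ⊓ (⨆ i ∈ Set.Iio n, E i) ⊓ Q = ⊥ := by
      refine hYess' _ (inf_le_left.trans inf_le_left) (le_bot_iff.1 ?_)
      refine hQ.disjoint.le_bot.trans' (le_inf ?_ (inf_le_left.trans inf_le_right))
      rw [← hEV]
      exact le_inf (inf_le_left.trans (inf_le_left.trans inf_le_right)) inf_le_right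
    have h2 : (⨆ i ∈ Set.Iio n, V i) ≤ Y ⊓ ⨆ i ∈ Set.Iio n, E i :=
      le_inf (hVnV.trans hVY) (iSup₂_mono fun i _ => hVE i)
    have h3 : Y ⊓ (⨆ i ∈ Set.Iio n, E i) = ⨆ i ∈ Set.Iio n, V i := by
      have h4 := sup_inf_assoc_of_le Q h2
      rw [hQ.sup_eq_top, top_inf_eq, inf_comm Q, h1, sup_bot_eq] at h4
      exact h4
    exact hVnV (h3.le ⟨hzY, hn (Submodule.mem_span_singleton_self z)⟩)
  have hYT : Y ⊔ T = T := by
    refine hDess _ (sup_le (hYx.trans hxD) (hTE.trans hED)) le_sup_right ?_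
    rw [sup_comm, sup_inf_assoc_of_le _ hTE]
    exact sup_eq_left.2 (hYE.trans hVT)
  have hYV : Y ≤ ⨆ k, V k := by
    have h1 : Y ≤ ⨆ k, E k := (le_sup_left.trans hYT.le).trans hTE
    rwa [inf_eq_left.2 h1] at hYE
  exact iSup_ne_fg_sup_iSup hVind hOV hOne (Submodule.fg_span_singleton y)
    ((le_antisymm hVY hYV).trans hY)

theorem false_of_simple_summands (hM : SubfactorCondition S M) (hcyc : Module.IsPrincipal S M)
    (hCS : IsCSModule S M) {W : ℕ → Submodule S M} (hW : iSupIndep W)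
    (hsimple : ∀ i, IsSimpleModule S (W i))
    (hsum : ∀ n, ∃ Q, IsCompl (⨆ i ∈ Set.Iio n, W i) Q) : False := by
  have hss : ∀ n, IsSemisimpleModule S ↥(⨆ i ∈ Set.Iio n, W i) := fun n =>
    isSemisimpleModule_biSup_of_isSemisimpleModule_submodule fun i _ => inferInstance
  have hW0 : ∀ i, W i ≠ ⊥ := fun i h => by
    have := IsSimpleModule.nontrivial S (W i)
    exact (Submodule.nontrivial_iff_ne_bot.1 this) h
  have hsummand : ∀ F : Submodule S M, F.FG → F ≤ ⨆ i, W i → ∃ F', IsCompl F F' := by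
    intro F hF hFW
    obtain ⟨n, hn⟩ := exists_le_biSup_Iio hF hFW
    obtain ⟨Q, hQ⟩ := hsum n
    exact exists_isCompl_of_le hQ hn
  have hnoeth : ∀ n, ∀ T ≤ ⨆ i ∈ Set.Iio n, W i, T.FG := by
    intro n T hT
    obtain ⟨Q, hQ⟩ := hsum n
    obtain ⟨T', hT'⟩ := exists_isCompl_of_le hQ hT
    exact fg_of_isCompl hcyc hT'
  -- blocks of simple submodules and their closures
  set B : ℕ → Submodule S M := fun k => ⨆ j, W (Nat.pair k j) with hBdef
  have hB : iSupIndep B := iSupIndep_iSup_pair hW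
  have hBW : (⨆ k, B k) = ⨆ i, W i := by
    rw [← iSup_unpair (fun k j => W (Nat.pair k j))]
    simp
  have hBfg : ∀ k, ¬ (B k).FG := fun k =>
    not_fg_iSup (hW.comp fun a b h => (Nat.pair_eq_pair.1 h).2) fun j => hW0 _
  choose E E' hEcompl hBE using fun k => exists_essential_closure hCS (B k)
  have hE : iSupIndep E := iSupIndep_of_isEssentialIn hB hBE
  have hEfg : ∀ k, (E k).FG := fun k => fg_of_isCompl hcyc (hEcompl k)
  have hBleE : ∀ k, B k ≤ E k := fun k => (hBE k).1
  have hBneE : ∀ k, B k ≠ E k := fun k h => hBfg k (h ▸ hEfg k)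
  set T := ⨆ k, B k with hT
  have hTE : T ≤ ⨆ k, E k := iSup_mono hBleE
  have hTfg : ¬ T.FG := by rw [hBW]; exact not_fg_iSup hW hW0
  obtain ⟨m, hm⟩ := hcyc.principal
  -- the closure of the blocks modulo the socle is generated by one element
  obtain ⟨D, x, hED, -, hD, hDess⟩ := exists_closure_modulo hM m hTfg hTE (hm ▸ le_top)
    (fun F hF => iSup_ne_fg_sup_iSup hE hBleE (fun n => ⟨n, le_rfl, hBneE n⟩) hF)
  have hinter : ∀ k, B k ⊓ (S ∙ x) ≠ ⊥ := by
    intro k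
    obtain ⟨n, hn⟩ := exists_le_sup_biSup_Iio (hEfg k)
      (hBW ▸ ((le_iSup E k).trans hED).trans hD.le : E k ≤ (S ∙ x) ⊔ ⨆ i, W i)
    exact inf_ne_bot_of_le_sup (hBfg k) (hnoeth n) ((hBleE k).trans hn)
  have hV : ∀ k, ∃ V : Submodule S M, V ≠ ⊥ ∧ V.FG ∧ V ≤ B k ∧ V ≤ S ∙ x := by
    intro k
    obtain ⟨z, hz, hz0⟩ := Submodule.exists_mem_ne_zero_of_ne_bot (hinter k)
    exact ⟨S ∙ z, by simpa using hz0, Submodule.fg_span_singleton z,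
      (Submodule.span_singleton_le_iff_mem _ _).2 hz.1,
      (Submodule.span_singleton_le_iff_mem _ _).2 hz.2⟩
  choose V hV0 hVfg hVB hVx using hV
  exact false_of_closure hM hE (fun k => (hVB k).trans (hBleE k)) hV0 hVfg (iSup_mono hVB) hTE hED
    (fun F hF h => hsummand F hF (hBW ▸ h)) (hD ▸ le_sup_left) hVx hDess

/-! ### Splitting off summands; no infinite direct sums -/

theorem disjoint_biSup_Iio_of_nested {A U : ℕ → Submodule S M} (hU : ∀ n, U n ≤ A n)
    (hA : ∀ n, A (n + 1) ≤ A n) (hd : ∀ n, Disjoint (U n) (A (n + 1))) (n : ℕ) :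
    Disjoint (⨆ i ∈ Set.Iio n, U i) (A n) := by
  induction n with
  | zero => simp
  | succ n ih =>
    have h1 : (⨆ i ∈ Set.Iio (n + 1), U i) = (⨆ i ∈ Set.Iio n, U i) ⊔ U n := by
      rw [show Set.Iio (n + 1) = insert n (Set.Iio n) from (Order.Iio_succ_eq_insert n), iSup_insert,
        sup_comm]
    rw [h1]
    exact Disjoint.disjoint_sup_left_of_disjoint_sup_right (hd n)
      (ih.mono_right (sup_le (hU n) (hA n)))

theorem iSupIndep_of_nested {A U : ℕ → Submodule S M} (hU : ∀ n, U n ≤ A n)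
    (hA : ∀ n, A (n + 1) ≤ A n) (hd : ∀ n, Disjoint (U n) (A (n + 1))) : iSupIndep U := by
  intro i
  have h1 : Disjoint (U i) (A (i + 1) ⊔ ⨆ j ∈ Set.Iio i, U j) :=
    (hd i).disjoint_sup_right_of_disjoint_sup_left
      ((disjoint_biSup_Iio_of_nested hU hA hd i).symm.mono_left (sup_le (hU i) (hA i)))
  refine h1.mono_right (iSup₂_le fun j hj => ?_)
  rcases lt_or_gt_of_ne hj with h | h
  · exact (le_iSup₂_of_le (f := fun j (_ : j ∈ Set.Iio i) => U j) j h le_rfl).trans le_sup_right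
  · exact ((hU j).trans (antitone_nat_of_succ_le hA (Nat.succ_le_of_lt h))).trans le_sup_left

/-- `A` contains an infinite direct sum of nonzero submodules. -/
def ContainsInfiniteDirectSum (A : Submodule S M) : Prop :=
  ∃ f : ℕ → Submodule S M, iSupIndep f ∧ (∀ i, f i ≠ ⊥) ∧ ∀ i, f i ≤ A

theorem exists_smaller_summand (hCS : IsCSModule S M) {A A' : Submodule S M} (hA : IsCompl A A')
    (h : ContainsInfiniteDirectSum A) : ∃ N N' : Submodule S M, IsCompl N N' ∧
      ContainsInfiniteDirectSum N ∧ N ≤ A ∧ A' ≤ N' ∧ A ⊓ N' ≠ ⊥ := by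
  obtain ⟨f, hf, hf0, hfA⟩ := h
  -- The even terms keep the new summand large; `f 1` is held back, and essentiality would fail on
  -- it if nothing were split off.
  obtain ⟨L, L', hL, hle, hess⟩ := exists_essential_closure hCS ((⨆ n, f (2 * n)) ⊔ A')
  have hA'L : A' ≤ L := le_sup_right.trans hle
  have hsup : (L ⊓ A) ⊔ A' = L := by
    rw [inf_comm, sup_comm, ← sup_inf_assoc_of_le _ hA'L, sup_comm, hA.sup_eq_top, top_inf_eq]
  have hLA' : L ⊓ (L' ⊔ A') = A' := by
    rw [inf_comm, sup_comm, sup_inf_assoc_of_le _ hA'L, inf_comm, hL.inf_eq_bot, sup_bot_eq]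
  have hcompl : IsCompl (L ⊓ A) (L' ⊔ A') := by
    refine IsCompl.of_eq ?_ ?_
    · rw [inf_comm L A, inf_assoc, hLA', hA.inf_eq_bot]
    · rw [sup_comm L', ← sup_assoc, hsup, hL.sup_eq_top]
  refine ⟨L ⊓ A, L' ⊔ A', hcompl, ⟨fun n => f (2 * n),
    hf.comp (f := fun n => 2 * n) fun a b h => by simpa using h, fun n => hf0 _,
    fun n => le_inf (((le_iSup (fun n => f (2 * n)) n).trans le_sup_left).trans hle) (hfA _)⟩,
    inf_le_right, le_sup_right, fun hbot => ?_⟩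
  have h1 : A ≤ L := by
    have h2 := sup_inf_assoc_of_le (L' ⊔ A') (inf_le_right : L ⊓ A ≤ A)
    rw [hcompl.sup_eq_top, top_inf_eq, inf_comm (L' ⊔ A'), hbot, sup_bot_eq] at h2
    exact h2.le.trans inf_le_left
  have h3 : Disjoint (f 1) (⨆ n, f (2 * n)) := by
    refine (hf 1).mono_right (iSup_le fun n => ?_)
    exact le_iSup₂_of_le (f := fun j (_ : j ≠ 1) => f j) (2 * n) (by omega) le_rfl
  have h4 : Disjoint (f 1) ((⨆ n, f (2 * n)) ⊔ A') :=
    h3.disjoint_sup_right_of_disjoint_sup_left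
      (hA.disjoint.mono_left (sup_le (hfA 1) (iSup_le fun n => hfA _)))
  exact hf0 1 (hess (f 1) ((hfA 1).trans h1) h4.eq_bot)

/-- Shrinking twice makes the piece split off non-simple: the first piece is a proper nonzero
submodule `X` of the combined one. -/
theorem exists_smaller_summand_of_lt (hCS : IsCSModule S M) {A A' : Submodule S M}
    (hA : IsCompl A A') (h : ContainsInfiniteDirectSum A) : ∃ N N' : Submodule S M,
      IsCompl N N' ∧ ContainsInfiniteDirectSum N ∧ N ≤ A ∧
      ∃ X ≠ ⊥, X < A ⊓ N' := by
  obtain ⟨N, N', hN, hNi, hNA, -, hNb⟩ := exists_smaller_summand hCS hA h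
  obtain ⟨P, P', hP, hPi, hPN, hNP', hPb⟩ := exists_smaller_summand hCS hN hNi
  refine ⟨P, P', hP, hPi, hPN.trans hNA, A ⊓ N', hNb,
    lt_of_le_of_ne (inf_le_inf_left _ hNP') fun h => hPb ?_⟩
  have h1 : N ⊓ P' ≤ N' := (inf_le_inf_right _ hNA).trans (h.ge.trans inf_le_right)
  exact le_bot_iff.1 (hN.disjoint.le_bot.trans' (le_inf inf_le_left h1))

theorem exists_seq_of_forall {α : Type*} {r : α → α → Prop} (h : ∀ a, ∃ b, r a b) (a : α) :
    ∃ s : ℕ → α, s 0 = a ∧ ∀ n, r (s n) (s (n + 1)) := by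
  choose g hg using h
  exact ⟨fun n => g^[n] a, rfl, fun n => by
    simpa only [Function.iterate_succ_apply'] using hg (g^[n] a)⟩

theorem inf_sup_le_of_disjoint {P A Q K L : Submodule S M} (hd : Disjoint P A) (hK : K ≤ P)
    (hL : L ≤ A) (hQ : Q = K ⊔ L) : (P ⊔ Q) ⊓ (A ⊔ Q) ≤ Q := by
  have h1 : P ⊔ Q = P ⊔ L := by rw [hQ, ← sup_assoc, sup_eq_left.2 hK]
  have h2 : A ⊔ Q = K ⊔ A := by
    rw [hQ, sup_comm K L, ← sup_assoc, sup_eq_left.2 hL, sup_comm]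
  rw [h1, h2, inf_comm, sup_inf_assoc_of_le _ (hK.trans le_sup_left), sup_comm P L, inf_comm,
    sup_inf_assoc_of_le _ hL, hd.eq_bot, sup_bot_eq, hQ]

theorem isSimpleModule_map_mkQ {U K Q : Submodule S M} (hK : K ⋖ U) (hQ : U ⊓ Q = K) :
    IsSimpleModule S (U.map Q.mkQ) := by
  rw [isSimpleModule_iff_isAtom]
  refine ⟨fun h => ?_, fun L hL => ?_⟩
  · rw [← le_bot_iff, Submodule.map_le_iff_le_comap, Submodule.comap_bot, Submodule.ker_mkQ] at h
    exact hK.lt.ne (hQ.symm.trans (inf_eq_left.2 h))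
  · have h1 : (U ⊓ L.comap Q.mkQ).map Q.mkQ = L := by
      rw [← Submodule.map_inf_eq_map_inf_comap, inf_eq_right.2 hL.le]
    have h2 : K ≤ U ⊓ L.comap Q.mkQ := by
      rw [← hQ]
      exact inf_le_inf_left _ (Submodule.le_comap_mkQ Q L)
    rcases hK.eq_or_eq h2 inf_le_left with h3 | h3
    · rw [← h1, h3, ← le_bot_iff, Submodule.map_le_iff_le_comap, Submodule.comap_bot,
        Submodule.ker_mkQ, ← hQ]
      exact inf_le_right
    · rw [h3] at h1
      exact absurd h1.symm hL.ne

theorem exists_covBy_of_fg {U X : Submodule S M} (hU : U.FG) (hX : X < U) :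
    ∃ K, X ≤ K ∧ K ⋖ U := by
  have := CompleteLattice.Iic_coatomic_of_compact_element ((Submodule.fg_iff_compact U).1 hU)
  rcases eq_top_or_exists_le_coatom (⟨X, hX.le⟩ : Set.Iic U) with h | ⟨K, hK, hXK⟩
  · exact absurd (congrArg Subtype.val h) hX.ne
  · exact ⟨K, hXK, Set.Iic.isCoatom_iff.1 hK⟩

theorem isCSModule_quotient_iSup (hM : SubfactorCondition S M) (hcyc : Module.IsPrincipal S M)
    {f K : ℕ → Submodule S M} (hf : iSupIndep f) (hK : ∀ i, K i ≤ f i)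
    (hKfg : ¬ (⨆ i, K i).FG) (hne : ∀ n, ∃ k, n ≤ k ∧ K k ≠ f k) :
    IsCSModule S (M ⧸ ⨆ i, K i) := by
  refine isCSModule_quotient hM hcyc hKfg fun hn => ?_
  have hfin := WellFoundedGT.finite_ne_bot_of_iSupIndep (iSupIndep_map_mkQ hf hK)
  obtain ⟨b, hb⟩ := hfin.bddAbove
  obtain ⟨k, hk, hkne⟩ := hne (b + 1)
  have := hb (show k ∈ _ from map_mkQ_ne_bot hf hK hkne)
  omega

theorem not_containsInfiniteDirectSum_of_isCSModule (hM : SubfactorCondition S M)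
    (hcyc : Module.IsPrincipal S M) (hCS : IsCSModule S M) :
    ¬ ContainsInfiniteDirectSum (⊤ : Submodule S M) := by
  intro h
  obtain ⟨s, hs0, hs⟩ := exists_seq_of_forall
    (α := {p : Submodule S M × Submodule S M // IsCompl p.1 p.2 ∧ ContainsInfiniteDirectSum p.1})
    (r := fun p q => q.1.1 ≤ p.1.1 ∧ ∃ X ≠ ⊥, X < p.1.1 ⊓ q.1.2)
    (fun p => by
      obtain ⟨N, N', h1, h2, h3, h4⟩ := exists_smaller_summand_of_lt hCS p.2.1 p.2.2
      exact ⟨⟨(N, N'), h1, h2⟩, h3, h4⟩) ⟨(⊤, ⊥), isCompl_top_bot, h⟩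
  set A : ℕ → Submodule S M := fun n => (s n).1.1 with hAdef
  set U : ℕ → Submodule S M := fun n => A n ⊓ (s (n + 1)).1.2 with hUdef
  have hUA : ∀ n, U n ≤ A n := fun n => inf_le_left
  have hA : ∀ n, A (n + 1) ≤ A n := fun n => (hs n).1
  have hcompl : ∀ n, IsCompl (A n) (s n).1.2 := fun n => (s n).2.1
  have hd : ∀ n, Disjoint (U n) (A (n + 1)) := fun n =>
    (hcompl (n + 1)).disjoint.symm.mono_left inf_le_right
  have hUA' : ∀ n, U n ⊔ A (n + 1) = A n := fun n => by
    have h1 := sup_inf_assoc_of_le (s (n + 1)).1.2 (hA n)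
    rw [(hcompl (n + 1)).sup_eq_top, top_inf_eq, inf_comm] at h1
    rw [sup_comm, h1]
  have hU : iSupIndep U := iSupIndep_of_nested hUA hA hd
  have hP : ∀ n, IsCompl (⨆ i ∈ Set.Iio n, U i) (A n) := fun n => by
    refine ⟨disjoint_biSup_Iio_of_nested hUA hA hd n, codisjoint_iff.2 ?_⟩
    induction n with
    | zero => simp [hAdef, hs0]
    | succ n ih =>
      refine top_le_iff.1 (ih.symm.le.trans (sup_le ?_ ?_))
      · exact (biSup_mono fun i hi => Nat.lt_succ_of_lt hi).trans le_sup_left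
      · rw [← hUA' n]
        exact sup_le_sup_right
          (le_iSup₂_of_le (f := fun i (_ : i ∈ Set.Iio (n + 1)) => U i) n (Nat.lt_succ_self n) le_rfl) _
  have hUfg : ∀ n, (U n).FG := fun n => by
    have h1 : IsCompl (U n) (A (n + 1) ⊔ ⨆ i ∈ Set.Iio n, U i) :=
      (hd n).isCompl_sup_right_of_isCompl_sup_left (by rw [hUA']; exact (hP n).symm)
    exact fg_of_isCompl hcyc h1
  -- Choosing `K` above the nonzero `X` keeps it nonzero, so that `⨆ K` is not finitely generated
  -- and the quotient is again CS.
  have hK : ∀ n, ∃ K, K ≠ ⊥ ∧ K ⋖ U n := fun n => by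
    obtain ⟨-, X, hX0, hX⟩ := hs n
    obtain ⟨K, hXK, hK⟩ := exists_covBy_of_fg (hUfg n) hX
    exact ⟨K, fun h => hX0 (le_bot_iff.1 (h ▸ hXK)), hK⟩
  choose K hK0 hKU using hK
  have hKle : ∀ n, K n ≤ U n := fun n => (hKU n).le
  have hCS' : IsCSModule S (M ⧸ ⨆ i, K i) := isCSModule_quotient_iSup hM hcyc hU hKle
    (not_fg_iSup (hU.mono hKle) hK0) fun n => ⟨n, le_rfl, (hKU n).ne⟩
  refine false_of_simple_summands (hM.quotient _) (isPrincipal_quotient hcyc _) hCS'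
    (iSupIndep_map_mkQ hU hKle)
    (fun i => isSimpleModule_map_mkQ (hKU i) (inf_iSup_of_le hU hKle i))
    fun n => ⟨(A n).map (⨆ i, K i).mkQ, ?_⟩
  have hmap : (⨆ i ∈ Set.Iio n, (U i).map (⨆ i, K i).mkQ) =
      (⨆ i ∈ Set.Iio n, U i).map (⨆ i, K i).mkQ := by
    simp only [Submodule.map_iSup]
  rw [hmap]
  refine IsCompl.of_eq ?_ ?_
  · apply Submodule.comap_injective_of_surjective (Submodule.mkQ_surjective _)
    rw [Submodule.comap_inf, Submodule.comap_map_mkQ, Submodule.comap_map_mkQ, Submodule.comap_bot,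
      Submodule.ker_mkQ]
    refine le_antisymm ?_ (le_inf le_sup_left le_sup_left)
    rw [sup_comm, sup_comm _ (A n)]
    refine inf_sup_le_of_disjoint (hP n).disjoint (K := ⨆ i ∈ Set.Iio n, K i)
      (L := ⨆ i ∈ (Set.Iio n)ᶜ, K i) (iSup₂_mono fun i _ => hKle i) (iSup₂_le fun i hi => ?_) ?_
    · exact ((hKle i).trans (hUA i)).trans (antitone_nat_of_succ_le hA (not_lt.1 hi))
    · rw [← iSup_union, Set.union_compl_self]; simp
  · rw [← Submodule.map_sup, (hP n).sup_eq_top, Submodule.map_top, Submodule.range_mkQ]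

theorem not_containsInfiniteDirectSum (hM : SubfactorCondition S M)
    (hcyc : Module.IsPrincipal S M) : ¬ ContainsInfiniteDirectSum (⊤ : Submodule S M) := by
  rintro ⟨f, hf, hf0, -⟩
  -- Odd terms make the factored submodule infinitely generated; even terms survive in the quotient.
  let K : ℕ → Submodule S M := fun k => if Odd k then f k else ⊥
  have hK : ∀ k, K k ≤ f k := fun k => by dsimp only [K]; split_ifs; exacts [le_rfl, bot_le]
  have hKeven : ∀ n, K (2 * n) ≠ f (2 * n) := fun n => by
    have : ¬ Odd (2 * n) := by simp
    simp only [K, if_neg this]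
    exact (hf0 _).symm
  have hKfg : ¬ (⨆ k, K k).FG := by
    have hle : (⨆ n, f (2 * n + 1)) = ⨆ k, K k := by
      refine le_antisymm (iSup_le fun n => le_iSup_of_le (2 * n + 1) ?_) (iSup_le fun k => ?_)
      · have : Odd (2 * n + 1) := ⟨n, rfl⟩
        simp only [K, if_pos this, le_refl]
      · by_cases hk : Odd k
        · obtain ⟨n, rfl⟩ := hk
          exact (hK _).trans (le_iSup (fun n => f (2 * n + 1)) n)
        · simp only [K, if_neg hk, bot_le]
    rw [← hle]
    exact not_fg_iSup (hf.comp (f := fun n => 2 * n + 1) fun a b h => by simpa using h) fun n => hf0 _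
  have hCS := isCSModule_quotient_iSup hM hcyc hf hK hKfg
    (fun n => ⟨2 * n, by omega, hKeven n⟩)
  refine not_containsInfiniteDirectSum_of_isCSModule (hM.quotient _) (isPrincipal_quotient hcyc _)
    hCS ⟨fun n => (f (2 * n)).map (⨆ k, K k).mkQ,
      (iSupIndep_map_mkQ hf hK).comp (f := fun n => 2 * n) fun a b h => by simpa using h,
      fun n => map_mkQ_ne_bot hf hK (hKeven n), fun _ => le_top⟩

/-! ### Finite uniform dimension -/

theorem exists_disjoint_of_not_isUniformModule {A : Submodule S M} (hA : A ≠ ⊥)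
    (h : ¬ IsUniformModule S A) : ∃ B B' : Submodule S M, B ≤ A ∧ B' ≤ A ∧ B ≠ ⊥ ∧ B' ≠ ⊥ ∧
      Disjoint B B' := by
  have := Submodule.nontrivial_iff_ne_bot.2 hA
  simp only [IsUniformModule, this, true_and, not_forall, not_not] at h
  obtain ⟨B, B', hB, hB', hd⟩ := h
  have hinj := A.injective_subtype
  refine ⟨B.map A.subtype, B'.map A.subtype, A.map_subtype_le B, A.map_subtype_le B', ?_, ?_, ?_⟩
  · rwa [Ne, (Submodule.map_injective_of_injective hinj).eq_iff' (Submodule.map_bot _)]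
  · rwa [Ne, (Submodule.map_injective_of_injective hinj).eq_iff' (Submodule.map_bot _)]
  · rw [disjoint_iff, ← Submodule.map_inf _ hinj, hd, Submodule.map_bot]

theorem exists_uniform_le (h : ¬ ContainsInfiniteDirectSum (⊤ : Submodule S M))
    {A : Submodule S M} (hA : A ≠ ⊥) : ∃ U ≤ A, IsUniformModule S U := by
  by_contra! hno
  obtain ⟨s, -, hs⟩ := exists_seq_of_forall
    (α := {B : Submodule S M // B ≠ ⊥ ∧ B ≤ A})
    (r := fun p q => q.1 ≤ p.1 ∧ ∃ X ≠ ⊥, X ≤ p.1 ∧ Disjoint X q.1)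
    (fun p => by
      obtain ⟨B, B', h1, h2, h3, h4, h5⟩ :=
        exists_disjoint_of_not_isUniformModule p.2.1 (hno p.1 p.2.2)
      exact ⟨⟨B', h4, h2.trans p.2.2⟩, h2, B, h3, h1, h5⟩) ⟨A, hA, le_rfl⟩
  choose hs1 X hX0 hXs hXd using hs
  exact h ⟨X, iSupIndep_of_nested (A := fun n => (s n).1) hXs hs1 hXd, hX0, fun _ => le_top⟩

theorem sSupIndep_insert {s : Set (Submodule S M)} (hs : sSupIndep s) {U : Submodule S M}
    (hU : Disjoint (sSup s) U) : sSupIndep (insert U s) := by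
  rintro x (rfl | hx)
  · exact hU.symm.mono_right (sSup_le_sSup (by simp))
  · refine Disjoint.mono_right (sSup_le ?_) ((hs hx).disjoint_sup_right_of_disjoint_sup_left
      (c := U) (hU.mono_left (sup_le (le_sSup hx) (sSup_le_sSup Set.sdiff_subset))))
    rintro y ⟨rfl | hy, hyx⟩
    · exact le_sup_right
    · exact (le_sSup (show y ∈ s \ {x} from ⟨hy, hyx⟩)).trans le_sup_left

/-- A maximal independent set of uniform submodules is finite, and a nonzero submodule missing its
sum would contain another uniform one to add. -/
theorem hasFiniteUniformDimension (h : ¬ ContainsInfiniteDirectSum (⊤ : Submodule S M)) :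
    HasFiniteUniformDimension S M := by
  obtain ⟨s, hs⟩ := zorn_subset {s : Set (Submodule S M) | (∀ U ∈ s, IsUniformModule S U) ∧ sSupIndep s}
    (fun c hc hch => ⟨⋃₀ c, ⟨fun U ⟨t, ht, hU⟩ => (hc ht).1 U hU,
      iSupIndep_sUnion_of_directed hch.directedOn fun t ht => (hc ht).2⟩,
      fun t ht => Set.subset_sUnion_of_mem ht⟩)
  have hfin : s.Finite := by
    by_contra hinf
    have hne : ∀ U ∈ s, U ≠ ⊥ := fun U hU => by
      have := (hs.prop.1 U hU).1
      exact Submodule.nontrivial_iff_ne_bot.1 this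
    let e := Set.Infinite.natEmbedding s hinf
    exact h ⟨fun n => (e n : Submodule S M), ((sSupIndep_iff s).1 hs.prop.2).comp e.injective,
      fun n => hne _ (e n).2, fun _ => le_top⟩
  have := hfin.fintype
  let e := Fintype.equivFin s
  refine ⟨Fintype.card s, fun i => (e.symm i : Submodule S M), fun i => hs.prop.1 _ (e.symm i).2,
    ((sSupIndep_iff s).1 hs.prop.2).comp e.symm.injective, fun K hK => ?_⟩
  have hsup : (⨆ i, (e.symm i : Submodule S M)) = sSup s := by
    rw [sSup_eq_iSup', e.symm.iSup_comp (g := fun x : s => (x : Submodule S M))]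
  rw [hsup] at hK
  by_contra hK0
  obtain ⟨U, hUK, hU⟩ := exists_uniform_le h hK0
  have hd : Disjoint (sSup s) U := (disjoint_iff.2 hK).mono_right hUK
  have hmem : U ∈ s := hs.le_of_ge (y := insert U s)
    ⟨by rintro V (rfl | hV); exacts [hU, hs.prop.1 V hV], sSupIndep_insert hs.prop.2 hd⟩
    (Set.subset_insert U s) (Set.mem_insert U s)
  have := hU.1
  exact Submodule.nontrivial_iff_ne_bot.1 this (disjoint_self.1 (hd.mono_left (le_sSup hmem)))

/-! ### Noetherianity from relative injectivity of simple modules -/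

theorem iSupIndep_map_mkQ_iInf {G H : ℕ → Submodule S M} (hGH : ∀ i j, i ≠ j → G i ≤ H j) :
    iSupIndep fun i => (G i).map (⨅ j, H j).mkQ := by
  intro i
  have h1 : (⨆ j, ⨆ _ : j ≠ i, (G j).map (⨅ j, H j).mkQ) ≤ (H i).map (⨅ j, H j).mkQ :=
    iSup₂_le fun j hj => Submodule.map_mono (hGH j i hj)
  refine Disjoint.mono_right h1 (disjoint_iff.2 ?_)
  apply Submodule.comap_injective_of_surjective (Submodule.mkQ_surjective _)
  rw [Submodule.comap_inf, Submodule.comap_map_mkQ, Submodule.comap_map_mkQ, Submodule.comap_bot,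
    Submodule.ker_mkQ]
  refine le_antisymm ?_ (le_inf le_sup_left le_sup_left)
  rw [sup_eq_right.2 (iInf_le H i), sup_inf_assoc_of_le _ (iInf_le H i)]
  refine sup_le le_rfl (le_iInf fun j => ?_)
  by_cases h : j = i
  · exact h ▸ inf_le_right
  · exact inf_le_left.trans (hGH i j (Ne.symm h))

theorem not_inf_biInf_le_of_coatoms {N H : ℕ → Submodule S M} (hN : Monotone N)
    (hH : ∀ n, IsCoatom (H n)) (hle : ∀ n, N n ≤ H n) (hnle : ∀ n, ¬ N (n + 1) ≤ H n) (n : ℕ) :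
    ¬ (N (n + 1) ⊓ ⨅ i ∈ Set.Iio n, H i) ≤ H n := by
  -- Descending induction on `m`: a witness outside `H n` is corrected by an element of `N (m + 1)`,
  -- which moves it into `H m` and changes nothing modulo the later `H i`.
  have key : ∀ k m, m + k = n → ¬ (N (n + 1) ⊓ ⨅ i ∈ Set.Ico m n, H i) ≤ H n := by
    intro k
    induction k with
    | zero =>
      intro m hm
      obtain rfl : m = n := hm
      simpa using hnle m
    | succ k ih =>
      intro m hm
      have hmn : m < n := by omega
      obtain ⟨y, ⟨hyN, hyH⟩, hyn⟩ := SetLike.not_le_iff_exists.1 (ih (m + 1) (by omega))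
      have htop : H m ⊔ N (m + 1) = ⊤ := (hH m).2 _ (left_lt_sup.2 (hnle m))
      obtain ⟨b, hb, a, ha, rfl⟩ := Submodule.mem_sup.1 (htop ▸ Submodule.mem_top : y ∈ H m ⊔ N (m + 1))
      have haH : ∀ i, m < i → a ∈ H i := fun i hi => hle i (hN (Nat.succ_le_of_lt hi) ha)
      have haN : a ∈ N (n + 1) := hN (by omega) ha
      refine SetLike.not_le_iff_exists.2
        ⟨b, Submodule.mem_inf.2 ⟨?_, ?_⟩, fun hbn => hyn (add_mem hbn (haH n hmn))⟩
      · simpa using sub_mem hyN haN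
      · simp only [Submodule.mem_iInf, SetLike.mem_coe] at hyH ⊢
        intro i hi
        rcases eq_or_lt_of_le hi.1 with h | h
        · exact h ▸ hb
        · simpa using sub_mem (hyH i ⟨h, hi.2⟩) (haH i h)
  have := key n 0 (by simp)
  simpa [Set.Ico, Set.Iio] using this

/-- Extend to `M` a map from `N'` onto a simple module that kills `N`; the kernel of the extension
is the coatom. -/
theorem exists_isCoatom_of_lt (hinj : ∀ I : Ideal S, I.IsMaximal → IsInjectiveRelativeTo S M (S ⧸ I))
    {N N' : Submodule S M} (hN' : N'.FG) (h : N < N') :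
    ∃ H, IsCoatom H ∧ N ≤ H ∧ ¬ N' ≤ H := by
  obtain ⟨K, hNK, hK⟩ := exists_covBy_of_fg hN' h
  obtain ⟨I, hI, ⟨e⟩⟩ := isSimpleModule_iff_quot_maximal.1 ((covBy_iff_quot_is_simple hK.le).1 hK)
  let f : N' →ₗ[S] S ⧸ I := e.toLinearMap ∘ₗ (K.submoduleOf N').mkQ
  have hf : Function.Surjective f := e.surjective.comp (Submodule.mkQ_surjective _)
  have hker : ∀ x : N', f x = 0 ↔ (x : M) ∈ K := fun x => by
    simp [f, Submodule.submoduleOf]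
  obtain ⟨g, hg⟩ := hinj I hI N' f
  have hgs : Function.Surjective g := fun y => by
    obtain ⟨x, rfl⟩ := hf y
    exact ⟨x, hg x⟩
  refine ⟨LinearMap.ker g, ?_, fun x hx => ?_, fun hle => hK.lt.not_ge fun x hx => ?_⟩
  · rw [← isSimpleModule_iff_isCoatom]
    exact isSimpleModule_iff_quot_maximal.2 ⟨I, hI, ⟨g.quotKerEquivOfSurjective hgs⟩⟩
  · rw [LinearMap.mem_ker, hg ⟨x, h.le hx⟩, hker]
    exact hNK hx
  · rw [← hker ⟨x, hx⟩, ← hg]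
    exact hle hx

/-- A strictly ascending chain of finitely generated submodules is separated by coatoms `H n`.
Modulo `⨅ H` the submodules `G n` become nonzero and independent, against (a) for this quotient. -/
theorem isNoetherian_of_injective (hM : SubfactorCondition S M) (hcyc : Module.IsPrincipal S M)
    (hinj : ∀ I : Ideal S, I.IsMaximal → IsInjectiveRelativeTo S M (S ⧸ I)) :
    IsNoetherian S M := by
  rw [isNoetherian_def]
  by_contra! hL
  obtain ⟨L, hL⟩ := hL
  obtain ⟨s, -, hs⟩ := exists_seq_of_forall
    (α := {F : Submodule S M // F.FG ∧ F ≤ L}) (r := fun p q => p.1 < q.1)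
    (fun p => by
      obtain ⟨x, hxL, hx⟩ := SetLike.exists_of_lt (lt_of_le_of_ne p.2.2 fun h => hL (h ▸ p.2.1))
      exact ⟨⟨p.1 ⊔ S ∙ x, p.2.1.sup (Submodule.fg_span_singleton x),
        sup_le p.2.2 ((Submodule.span_singleton_le_iff_mem _ _).2 hxL)⟩,
        left_lt_sup.2 (by simpa using hx)⟩) ⟨⊥, Submodule.fg_bot, bot_le⟩
  choose H hH hle hnle using fun n => exists_isCoatom_of_lt hinj (s (n + 1)).2.1 (hs n)
  let N : ℕ → Submodule S M := fun n => (s n).1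
  have hN : Monotone N := monotone_nat_of_le_succ fun n => (hs n).le
  let G : ℕ → Submodule S M := fun n => N (n + 1) ⊓ ⨅ i ∈ Set.Iio n, H i
  have hG : ∀ n, ¬ G n ≤ H n := not_inf_biInf_le_of_coatoms hN hH hle hnle
  refine not_containsInfiniteDirectSum (hM.quotient (⨅ j, H j)) (isPrincipal_quotient hcyc _)
    ⟨fun i => (G i).map (⨅ j, H j).mkQ, iSupIndep_map_mkQ_iInf fun i j hij => ?_, fun i h => ?_,
      fun _ => le_top⟩
  · rcases lt_or_gt_of_ne hij with h | h
    · exact inf_le_left.trans ((hN (Nat.succ_le_of_lt h)).trans (hle j))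
    · exact inf_le_right.trans (iInf₂_le (f := fun i (_ : i ∈ Set.Iio _) => H i) j h)
  · rw [← le_bot_iff, Submodule.map_le_iff_le_comap, Submodule.comap_bot, Submodule.ker_mkQ] at h
    exact hG i (h.trans (iInf_le H i))

/-! ### Splitting over right WV-rings -/

theorem IsInjectiveRelativeTo.of_equiv {M' E : Type*} [AddCommGroup M'] [Module S M']
    [AddCommGroup E] [Module S E] (e : M ≃ₗ[S] M') (h : IsInjectiveRelativeTo S M E) :
    IsInjectiveRelativeTo S M' E := by
  intro N f
  obtain ⟨g, hg⟩ := h (N.comap e.toLinearMap) (f ∘ₗ e.toLinearMap.restrict fun x hx => hx)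
  refine ⟨g ∘ₗ e.symm.toLinearMap, fun x => ?_⟩
  have h1 := hg ⟨e.symm x, by simp⟩
  rw [LinearMap.comp_apply, LinearEquiv.coe_coe, h1, LinearMap.comp_apply]
  congr 1
  exact Subtype.ext (e.apply_symm_apply x)

theorem exists_isCompl_of_projective_quotient (N : Submodule S M)
    [Module.Projective S (M ⧸ N)] : ∃ B, IsCompl N B := by
  obtain ⟨s, hs⟩ := Module.projective_lifting_property N.mkQ LinearMap.id N.mkQ_surjective
  have hs' : ∀ x, N.mkQ (s x) = x := fun x => LinearMap.congr_fun hs x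
  refine ⟨LinearMap.range s, IsCompl.of_eq ?_ ?_⟩
  · rw [eq_bot_iff]
    rintro _ ⟨hx, y, rfl⟩
    have : y = 0 := by rw [← hs' y]; simpa using hx
    simp [this]
  · refine eq_top_iff.2 fun x _ => Submodule.mem_sup.2
      ⟨x - s (N.mkQ x), ?_, s (N.mkQ x), ⟨_, rfl⟩, sub_add_cancel _ _⟩
    exact (Submodule.Quotient.mk_eq_zero N).1 (by
      rw [← Submodule.mkQ_apply, map_sub, hs', sub_self])

theorem exists_ne_bot_not_isNoetherian_quotient (h : ¬ IsNoetherian S M) :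
    ∃ N : Submodule S M, N ≠ ⊥ ∧ ¬ IsNoetherian S (M ⧸ N) := by
  rw [isNoetherian_def] at h
  push Not at h
  obtain ⟨L, hL⟩ := h
  obtain ⟨x, hx, hx0⟩ := Submodule.exists_mem_ne_zero_of_ne_bot
    (show L ≠ ⊥ from fun h => hL (h ▸ Submodule.fg_bot))
  refine ⟨S ∙ x, by simpa using hx0, fun hn => hL ?_⟩
  refine Submodule.fg_of_fg_map_of_fg_inf_ker (S ∙ x).mkQ (hn.noetherian _) ?_
  rw [Submodule.ker_mkQ, inf_eq_right.2 ((Submodule.span_singleton_le_iff_mem _ _).2 hx)]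
  exact Submodule.fg_span_singleton x

end Submodules

section WV

variable {R : Type u} [Ring R] {C : Type v} [AddCommGroup C] [Module Rᵐᵒᵖ C]

variable (R) in
/-- The ring as a right module over itself, viewed as a left module over the opposite ring. -/
def rightRegularEquiv : R ≃ₗ[Rᵐᵒᵖ] Rᵐᵒᵖ where
  toFun := MulOpposite.op
  invFun := MulOpposite.unop
  map_add' _ _ := rfl
  map_smul' _ _ := rfl
  left_inv _ := rfl
  right_inv _ := rfl

theorem exists_quotient_equiv (hC : Module.IsPrincipal Rᵐᵒᵖ C) :
    ∃ A : Submodule Rᵐᵒᵖ R, Nonempty ((R ⧸ A) ≃ₗ[Rᵐᵒᵖ] C) := by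
  obtain ⟨c, hc⟩ := hC.principal
  let f : R →ₗ[Rᵐᵒᵖ] C := LinearMap.toSpanSingleton Rᵐᵒᵖ C c ∘ₗ (rightRegularEquiv R).toLinearMap
  have hf : Function.Surjective f := by
    refine Function.Surjective.comp (g := LinearMap.toSpanSingleton Rᵐᵒᵖ C c) ?_
      (rightRegularEquiv R).surjective
    rw [← LinearMap.range_eq_top, LinearMap.range_toSpanSingleton, hc]
  exact ⟨LinearMap.ker f, ⟨f.quotKerEquivOfSurjective hf⟩⟩

theorem isNoetherian_or_equiv (hR : IsRightWVRing R) (hC : Module.IsPrincipal Rᵐᵒᵖ C)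
    (hsub : SubfactorCondition Rᵐᵒᵖ C) :
    IsNoetherian Rᵐᵒᵖ C ∨ Nonempty (C ≃ₗ[Rᵐᵒᵖ] R) := by
  obtain ⟨A, ⟨e⟩⟩ := exists_quotient_equiv hC
  by_cases hA : Nonempty ((R ⧸ A) ≃ₗ[Rᵐᵒᵖ] R)
  · exact Or.inr (hA.map e.symm.trans)
  · refine Or.inl (isNoetherian_of_injective hsub hC fun I hI => ?_)
    refine IsInjectiveRelativeTo.of_equiv e (hR A hA _ ?_)
    exact isSimpleModule_iff_quot_maximal.2 ⟨I, hI, ⟨LinearEquiv.refl _ _⟩⟩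

theorem exists_isCompl_not_isNoetherian (hR : IsRightWVRing R) (hC : Module.IsPrincipal Rᵐᵒᵖ C)
    (hsub : SubfactorCondition Rᵐᵒᵖ C) (hn : ¬ IsNoetherian Rᵐᵒᵖ C) :
    ∃ N B : Submodule Rᵐᵒᵖ C, Disjoint N B ∧ N ≠ ⊥ ∧ Module.IsPrincipal Rᵐᵒᵖ B ∧
      ¬ IsNoetherian Rᵐᵒᵖ B := by
  obtain ⟨N, hN, hNn⟩ := exists_ne_bot_not_isNoetherian_quotient hn
  have hQ := isPrincipal_quotient hC N
  obtain ⟨e⟩ := (isNoetherian_or_equiv hR hQ (hsub.quotient N)).resolve_left hNn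
  have : Module.Projective Rᵐᵒᵖ (C ⧸ N) :=
    Module.Projective.of_equiv (e.trans (rightRegularEquiv R)).symm
  obtain ⟨B, hB⟩ := exists_isCompl_of_projective_quotient N
  let e' := Submodule.quotientEquivOfIsCompl N B hB
  refine ⟨N, B, hB.disjoint, hN, hQ.of_surjective e'.toLinearMap e'.surjective, fun h => hNn ?_⟩
  exact isNoetherian_of_linearEquiv e'.symm

theorem isNoetherian_of_isRightWVRing (hR : IsRightWVRing R) (hC : Module.IsPrincipal Rᵐᵒᵖ C)
    (hsub : SubfactorCondition Rᵐᵒᵖ C) : IsNoetherian Rᵐᵒᵖ C := by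
  by_contra hn
  let e : C ≃ₗ[Rᵐᵒᵖ] (⊤ : Submodule Rᵐᵒᵖ C) := Submodule.topEquiv.symm
  -- The complement `B` is again cyclic and non-noetherian, so the splitting repeats; the pieces `N`
  -- form the forbidden direct sum.
  obtain ⟨s, -, hs⟩ := exists_seq_of_forall
    (α := {A : Submodule Rᵐᵒᵖ C // Module.IsPrincipal Rᵐᵒᵖ A ∧ ¬ IsNoetherian Rᵐᵒᵖ A})
    (r := fun p q => q.1 ≤ p.1 ∧ ∃ X ≠ ⊥, X ≤ p.1 ∧ Disjoint X q.1)
    (fun p => by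
      obtain ⟨A, hA, hAn⟩ := p
      obtain ⟨N, B, hd, hN, hB, hBn⟩ :=
        exists_isCompl_not_isNoetherian hR hA (hsub.submodule A) hAn
      have hinj := A.injective_subtype
      let e' : B ≃ₗ[Rᵐᵒᵖ] B.map A.subtype := Submodule.equivSubtypeMap A B
      refine ⟨⟨B.map A.subtype, hB.of_surjective e'.toLinearMap e'.surjective,
        fun h => hBn (isNoetherian_of_linearEquiv e'.symm)⟩, A.map_subtype_le B,
        N.map A.subtype, ?_, A.map_subtype_le N, ?_⟩
      · rwa [Ne, (Submodule.map_injective_of_injective hinj).eq_iff' (Submodule.map_bot _)]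
      · rw [disjoint_iff, ← Submodule.map_inf _ hinj, hd.eq_bot, Submodule.map_bot])
    ⟨⊤, hC.of_surjective e.toLinearMap e.surjective,
      fun h => hn (isNoetherian_of_linearEquiv e.symm)⟩
  choose hs1 X hX0 hXs hXd using hs
  exact not_containsInfiniteDirectSum hsub hC
    ⟨X, iSupIndep_of_nested (A := fun n => (s n).1) hXs hs1 hXd, hX0, fun _ => le_top⟩

end WV

end CyclicSubfactor

theorem theorem11 {R : Type u} [Ring R] {C : Type v} [AddCommGroup C] [Module Rᵐᵒᵖ C]
    (hC : Module.IsPrincipal Rᵐᵒᵖ C)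
    (hsub : ∀ (X : Submodule Rᵐᵒᵖ C) (D : Submodule Rᵐᵒᵖ X),
      Module.IsPrincipal Rᵐᵒᵖ (X ⧸ D) →
        IsCSModule Rᵐᵒᵖ (X ⧸ D) ∨ IsNoetherian Rᵐᵒᵖ (X ⧸ D) ∨ Module.Projective Rᵐᵒᵖ (X ⧸ D)) :
    HasFiniteUniformDimension Rᵐᵒᵖ C ∧ (IsRightWVRing R → IsNoetherian Rᵐᵒᵖ C) := by
  have h := CyclicSubfactor.subfactorCondition_of_forall hsub
  exact ⟨CyclicSubfactor.hasFiniteUniformDimension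
    (CyclicSubfactor.not_containsInfiniteDirectSum h hC),
    fun hR => CyclicSubfactor.isNoetherian_of_isRightWVRing hR hC h⟩
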